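/- Let $X$ be a connected, locally path connected topological space and let $x_0\in X$. Suppose that $X$ is a strong small loop transfer (strong SLT) space at $x_0$, that is: for every $x\in X$ and every neighbourhood $U$ of $x_0$ there is a neighbourhood $V$ of $x$ such that for every path $\alpha$ in $X$ from $x_0$ to $x$ and every loop $\beta$ in $V$ based at $x$ there is a loop $\gamma$ in $U$ based at $x_0$ that is homotopic to $\alpha*\beta*\alpha^{-1}$ relative to the endpoints. A continuous map $p:\widetilde X\to X$ is called a generalized covering map if $\widetilde X$ is connected and locally path connected and $p$ has the unique lifting property: for every $\tilde x\in\widetilde X$, every connected, locally path connected pointed space $(Y,y_0)$ and every continuous map $f:(Y,y_0)\to(X,p(\tilde x))$ with $f_*\pi_1(Y,y_0)\subseteq p_*\pi_1(\widetilde X,\tilde x)$, there is a unique continuous map $\tilde f:(Y,y_0)\to(\widetilde X,\tilde x)$ with $p\circ\tilde f=f$. A subgroup of $\pi_1(X,x_0)$ is called a generalized covering subgroup (respectively, a covering subgroup) if it equals $p_*\pi_1(\widetilde X,\tilde x_0)$ for some generalized covering map (respectively, some covering map with $\widetilde X$ connected) $p:\widetilde X\to X$ and some $\tilde x_0\in p^{-1}(x_0)$.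 Then a subgroup $H\le\pi_1(X,x_0)$ is a generalized covering subgroup if and only if $H$ is equal to the intersection of all covering subgroups of $\pi_1(X,x_0)$ that contain $H$. -/

import Mathlib

universe u

/-- `X` is a strong small loop transfer space at `x₀`: for every `x` and every neighbourhood `U`
of `x₀` there is a neighbourhood `V` of `x` such that for every path `α` from `x₀` to `x` and
every loop `β` in `V` based at `x`, some loop `γ` in `U` based at `x₀` is homotopic, relative to
the endpoints, to `α * β * α⁻¹`. -/
def IsStrongSLTAt {X : Type u} [TopologicalSpace X] (x₀ : X) : Prop :=
  ∀ x : X, ∀ U ∈ nhds x₀, ∃ V ∈ nhds x, ∀ (α : Path x₀ x) (β : Path x x),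
    Set.range β ⊆ V →
      ∃ γ : Path x₀ x₀, Set.range γ ⊆ U ∧ γ.Homotopic ((α.trans β).trans α.symm)

/-- The unique lifting property of a continuous map `p : E → X`: for every `e₀ : E`, every
connected, locally path connected pointed space `(Y, y₀)` and every continuous map
`f : (Y, y₀) → (X, p e₀)` with `f_* π₁(Y, y₀) ⊆ p_* π₁(E, e₀)`, there is a unique continuous
`g : (Y, y₀) → (E, e₀)` with `p ∘ g = f`. -/
def HasUniqueLiftingProperty {E X : Type u} [TopologicalSpace E] [TopologicalSpace X]
    (p : C(E, X)) : Prop :=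
  ∀ (Y : Type u) [TopologicalSpace Y] [ConnectedSpace Y] [LocallyPathConnectedSpace Y]
    (y₀ : Y) (e₀ : E) (f : C(Y, X)) (hf : f y₀ = p e₀),
    (FundamentalGroup.mapOfEq f hf).range ≤ (FundamentalGroup.map p e₀).range →
      ∃! g : C(Y, E), g y₀ = e₀ ∧ p.comp g = f

/-- A generalized covering map: a continuous map with the unique lifting property whose domain
is connected and locally path connected. -/
structure IsGeneralizedCoveringMap {E X : Type u} [TopologicalSpace E] [TopologicalSpace X]
    (p : C(E, X)) : Prop where
  connectedSpace : ConnectedSpace E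
  locallyPathConnectedSpace : LocallyPathConnectedSpace E
  hasUniqueLiftingProperty : HasUniqueLiftingProperty p

/-- `H ≤ π₁(X, x₀)` is a generalized covering subgroup if `H = p_* π₁(E, e₀)` for some
generalized covering map `p : (E, e₀) → (X, x₀)`. -/
def IsGeneralizedCoveringSubgroup {X : Type u} [TopologicalSpace X] {x₀ : X}
    (H : Subgroup (FundamentalGroup X x₀)) : Prop :=
  ∃ (E : Type u) (_ : TopologicalSpace E) (p : C(E, X)) (e₀ : E) (h : p e₀ = x₀),
    IsGeneralizedCoveringMap p ∧ (FundamentalGroup.mapOfEq p h).range = H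

/-- `K ≤ π₁(X, x₀)` is a covering subgroup if `K = p_* π₁(E, e₀)` for some covering map
`p : (E, e₀) → (X, x₀)` with `E` connected. -/
def IsCoveringSubgroup {X : Type u} [TopologicalSpace X] {x₀ : X}
    (K : Subgroup (FundamentalGroup X x₀)) : Prop :=
  ∃ (E : Type u) (_ : TopologicalSpace E) (p : C(E, X)) (e₀ : E) (h : p e₀ = x₀),
    ConnectedSpace E ∧ IsCoveringMap p ∧ (FundamentalGroup.mapOfEq p h).range = K

open Topology unitInterval Filter Set

/-! Let `H = p_* π₁(E, e₀)` for a generalized covering `p`, and let `g` lie in all covering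
subgroups above `H`. Strong SLT makes every subgroup containing the loops of some neighbourhood of
`x₀` a covering subgroup (`isCoveringSubgroup_of_smallLoopSubgroup_le`) and makes conjugates of very
small loops small. Hence `g = n * h` with `h ∈ H` and `n` as small as desired
(`exists_mul_eq_of_mem_sInf`). As `h` lifts to a loop, the lift of `g` ends where the lift of each
such `n` ends. Lifting the whole shrinking family at once, from a contractible hedgehog, shows that
the lifts shrink too (`eventually_lift_mem`). So this endpoint lies in every neighbourhood of `e₀`,
which forces it to be `e₀` (`eq_of_specializes`), and `g ∈ H`.

Conversely, an intersection of covering subgroups comes from the fibre product of the coverings,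
where a path lifts to a loop iff it does so in each factor. To be locally path connected, the
product is given a finer topology with the same paths, and one path component is kept. -/

theorem Homeomorph.locallyPathConnectedSpace {X Y : Type*} [TopologicalSpace X]
    [TopologicalSpace Y] [LocallyPathConnectedSpace X] (e : X ≃ₜ Y) :
    LocallyPathConnectedSpace Y :=
  e.symm.isOpenEmbedding.locallyPathConnectedSpace

instance unitInterval.locallyPathConnectedSpace : LocallyPathConnectedSpace I :=
  (convex_Icc (0 : ℝ) 1).locallyPathConnectedSpace

instance unitInterval.contractibleSpace : ContractibleSpace I :=
  (convex_Icc (0 : ℝ) 1).contractibleSpace ⟨0, unitInterval.zero_mem⟩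

/-! ### Lifting paths and homotopies -/

namespace HasUniqueLiftingProperty

variable {E X : Type u} [TopologicalSpace E] [TopologicalSpace X] {p : C(E, X)}

theorem existsUnique_lift_of_simplyConnectedSpace (hp : HasUniqueLiftingProperty p) {Y : Type u}
    [TopologicalSpace Y] [SimplyConnectedSpace Y] [LocallyPathConnectedSpace Y] (f : C(Y, X))
    (y₀ : Y) (e₀ : E) (hf : f y₀ = p e₀) : ∃! g : C(Y, E), g y₀ = e₀ ∧ p.comp g = f := by
  refine hp Y y₀ e₀ f hf ?_
  rintro _ ⟨a, rfl⟩
  rw [Subsingleton.elim a 1, map_one]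
  exact one_mem _

/-- The lifting property for test spaces in the lowest universe. -/
theorem existsUnique_lift_of_simplyConnectedSpace' (hp : HasUniqueLiftingProperty p) {Y : Type}
    [TopologicalSpace Y] [SimplyConnectedSpace Y] [LocallyPathConnectedSpace Y] (f : C(Y, X))
    (y₀ : Y) (e₀ : E) (hf : f y₀ = p e₀) : ∃! g : C(Y, E), g y₀ = e₀ ∧ p.comp g = f := by
  let φ : ULift.{u} Y ≃ₜ Y := Homeomorph.ulift
  have : LocallyPathConnectedSpace (ULift.{u} Y) := φ.symm.locallyPathConnectedSpace
  have : SimplyConnectedSpace (ULift.{u} Y) := φ.toHomotopyEquiv.simplyConnectedSpace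
  obtain ⟨g, ⟨hg₀, hg⟩, huniq⟩ := hp.existsUnique_lift_of_simplyConnectedSpace
    (f.comp φ) (φ.symm y₀) e₀ (by simpa using hf)
  refine ⟨g.comp φ.symm, ⟨hg₀, ?_⟩, fun g' ⟨hg'₀, hg'⟩ ↦ ?_⟩
  · ext y
    simpa using DFunLike.congr_fun hg (φ.symm y)
  · rw [← huniq (g'.comp φ) ⟨by simpa using hg'₀, by rw [← hg']; rfl⟩]
    ext y
    simp

theorem exists_path_lift (hp : HasUniqueLiftingProperty p) {x y : X} (γ : Path x y) {e₀ : E}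
    (h : p e₀ = x) : ∃ Γ : C(I, E), Γ 0 = e₀ ∧ ∀ t, p (Γ t) = γ t := by
  obtain ⟨Γ, ⟨h₀, h₁⟩, -⟩ := hp.existsUnique_lift_of_simplyConnectedSpace' (γ : C(I, X)) 0 e₀
    (by simp [h])
  exact ⟨Γ, h₀, fun t ↦ DFunLike.congr_fun h₁ t⟩

theorem path_lift_unique (hp : HasUniqueLiftingProperty p) {Γ Γ' : C(I, E)}
    (h₀ : Γ 0 = Γ' 0) (h : ∀ t, p (Γ t) = p (Γ' t)) : Γ = Γ' :=
  (hp.existsUnique_lift_of_simplyConnectedSpace' (p.comp Γ) 0 (Γ 0) rfl).unique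
    ⟨rfl, rfl⟩ ⟨h₀.symm, ContinuousMap.ext fun t ↦ (h t).symm⟩

/-- The path that stays at `e` on `[0, 1)` and jumps to `e'` at `1` is continuous. It lifts a
constant path, so it is constant. -/
theorem eq_of_specializes (hp : HasUniqueLiftingProperty p) {e e' : E} (h : e ⤳ e')
    (he : p e = p e') : e = e' := by
  classical
  let Γ : C(I, E) := ⟨Set.piecewise {1} (fun _ ↦ e') (fun _ ↦ e),
    isClosed_singleton.continuous_piecewise_of_specializes continuous_const continuous_const
      fun _ ↦ h⟩
  have h0 : Γ 0 = e := by simp [Γ]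
  have h1 : Γ 1 = e' := by simp [Γ]
  have : Γ = .const I e := hp.path_lift_unique (by simpa using h0) fun t ↦ by
    by_cases ht : t = 1
    · subst ht
      simp [h1, he]
    · simp [Γ, ht]
  rw [← h1, this]
  rfl

/-- In a lift of the homotopy, the sides over the fixed endpoints lift constant paths, so they are
constant. -/
theorem lift_one_eq_of_homotopic (hp : HasUniqueLiftingProperty p) {x y : X} {γ γ' : Path x y}
    (h : γ.Homotopic γ') {Γ Γ' : C(I, E)} (hΓ : ∀ t, p (Γ t) = γ t) (hΓ' : ∀ t, p (Γ' t) = γ' t)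
    (h₀ : Γ 0 = Γ' 0) : Γ 1 = Γ' 1 := by
  obtain ⟨H⟩ := h
  obtain ⟨G, ⟨hG₀, hG⟩, -⟩ := hp.existsUnique_lift_of_simplyConnectedSpace'
    (H : C(I × I, X)) (0, 0) (Γ 0) (by simp [hΓ])
  have hG' (s t : I) : p (G (s, t)) = H (s, t) := DFunLike.congr_fun hG (s, t)
  have hleft : G.comp ⟨fun s ↦ (s, 0), by fun_prop⟩ = .const I (Γ 0) :=
    hp.path_lift_unique (by simpa using hG₀) fun s ↦ by simp [hG', hΓ]
  have hleft' (s : I) : G (s, 0) = Γ 0 := DFunLike.congr_fun hleft s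
  have hright : G.comp ⟨fun s ↦ (s, 1), by fun_prop⟩ = .const I (G (0, 1)) :=
    hp.path_lift_unique (by simp) fun s ↦ by simp [hG']
  have hright' (s : I) : G (s, 1) = G (0, 1) := DFunLike.congr_fun hright s
  have hbot : G.comp ⟨fun t ↦ (0, t), by fun_prop⟩ = Γ :=
    hp.path_lift_unique (by simp [hleft']) fun t ↦ by simp [hG', hΓ]
  have htop : G.comp ⟨fun t ↦ (1, t), by fun_prop⟩ = Γ' :=
    hp.path_lift_unique (by simp [hleft', h₀]) fun t ↦ by simp [hG', hΓ']
  have h1 : G (0, 1) = Γ 1 := DFunLike.congr_fun hbot 1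
  have h2 : G (1, 1) = Γ' 1 := DFunLike.congr_fun htop 1
  rw [← h1, ← h2, hright' 1]

end HasUniqueLiftingProperty

/-! ### The hedgehog of a filter -/

/-- The one-point union at `0` of copies of the unit interval indexed by `ι`, without identifying
the copies of `0`: these are made inseparable instead, and their neighbourhoods contain `F`-almost
all of the copies. -/
structure Hedgehog {ι : Type u} (F : Filter ι) : Type u where
  /-- The index of the spine. -/
  spine : ι
  /-- The coordinate on the spine. -/
  coord : I

namespace Hedgehog

variable {ι : Type u} {F : Filter ι}

/-- Keeping the copies of `0` distinct avoids a quotient. The last condition makes continuity at `0`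
mean that the spines shrink along `F`. -/
instance : TopologicalSpace (Hedgehog F) where
  IsOpen O := (∀ i, IsOpen (mk (F := F) i ⁻¹' O)) ∧
    ∀ i, mk i 0 ∈ O → (∀ j, mk j 0 ∈ O) ∧ ∀ᶠ j in F, ∀ t, mk j t ∈ O
  isOpen_univ := ⟨fun i ↦ isOpen_univ, fun i _ ↦ ⟨fun _ ↦ trivial, .of_forall fun _ _ ↦ trivial⟩⟩
  isOpen_inter O O' hO hO' := ⟨fun i ↦ (hO.1 i).inter (hO'.1 i), fun i hi ↦
    ⟨fun j ↦ ⟨(hO.2 i hi.1).1 j, (hO'.2 i hi.2).1 j⟩, by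
      filter_upwards [(hO.2 i hi.1).2, (hO'.2 i hi.2).2] with j h h' t using ⟨h t, h' t⟩⟩⟩
  isOpen_sUnion S hS := by
    refine ⟨fun i ↦ ?_, ?_⟩
    · rw [preimage_sUnion]
      exact isOpen_biUnion fun O hO ↦ (hS O hO).1 i
    · rintro i ⟨O, hO, hi⟩
      obtain ⟨h, h'⟩ := (hS O hO).2 i hi
      exact ⟨fun j ↦ ⟨O, hO, h j⟩, h'.mono fun j hj t ↦ ⟨O, hO, hj t⟩⟩

theorem isOpen_iff {O : Set (Hedgehog F)} :
    IsOpen O ↔ (∀ i, IsOpen (mk (F := F) i ⁻¹' O)) ∧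
      ∀ i, mk i 0 ∈ O → (∀ j, mk j 0 ∈ O) ∧ ∀ᶠ j in F, ∀ t, mk j t ∈ O :=
  Iff.rfl

theorem continuous_mk (i : ι) : Continuous (mk (F := F) i) :=
  ⟨fun _ hO ↦ (isOpen_iff.1 hO).1 i⟩

theorem isOpen_image_mk {i : ι} {A : Set I} (hA : IsOpen A) (h0 : 0 ∉ A) :
    IsOpen (mk (F := F) i '' A) := by
  refine isOpen_iff.2 ⟨fun j ↦ ?_, ?_⟩
  · by_cases hij : i = j
    · subst hij
      rwa [preimage_image_eq _ fun s t h ↦ ((mk.injEq ..).mp h).2]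
    · convert isOpen_empty
      ext t
      simp [mk.injEq, hij]
  · rintro j ⟨t, ht, h⟩
    exact absurd (((mk.injEq ..).mp h).2 ▸ ht) h0

theorem inseparable_mk_zero (i j : ι) : Inseparable (mk (F := F) i 0) (mk (F := F) j 0) :=
  inseparable_iff_forall_isOpen.2 fun _ hO ↦
    ⟨fun h ↦ ((isOpen_iff.1 hO).2 i h).1 j, fun h ↦ ((isOpen_iff.1 hO).2 j h).1 i⟩

theorem continuous_iff {Z : Type*} [TopologicalSpace Z] {f : Hedgehog F → Z} {z : Z}
    (h0 : ∀ i, f (mk (F := F) i 0) = z) :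
    Continuous f ↔ (∀ i, Continuous fun t ↦ f (mk (F := F) i t)) ∧
      ∀ U ∈ 𝓝 z, ∀ᶠ i in F, ∀ t, f (mk (F := F) i t) ∈ U := by
  refine ⟨fun h ↦ ⟨fun i ↦ h.comp (continuous_mk i), fun U hU ↦ ?_⟩, fun ⟨h, h'⟩ ↦ ⟨fun O hO ↦ ?_⟩⟩
  · obtain ⟨V, hVU, hV, hz⟩ := mem_nhds_iff.1 hU
    rcases isEmpty_or_nonempty ι with hι | ⟨⟨i⟩⟩
    · exact .of_forall fun i ↦ hι.elim i
    · have := ((isOpen_iff.1 (hV.preimage h)).2 i (by simpa [h0] using hz)).2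
      exact this.mono fun j hj t ↦ hVU (hj t)
  · refine isOpen_iff.2 ⟨fun i ↦ hO.preimage (h i), fun i hi ↦ ⟨fun j ↦ ?_, h' O (hO.mem_nhds ?_)⟩⟩
    · rw [mem_preimage, h0] at hi ⊢
      exact hi
    · rwa [mem_preimage, h0] at hi

/-- The points that can be moved to `0` along their spine inside `O`. -/
def core (O : Set (Hedgehog F)) : Set (Hedgehog F) :=
  {y | ∀ s : I, mk y.spine (s * y.coord) ∈ O}

theorem mk_mem_core {O : Set (Hedgehog F)} {i : ι} {t : I} :
    mk (F := F) i t ∈ core O ↔ ∀ s : I, mk (F := F) i (s * t) ∈ O :=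
  Iff.rfl

theorem isOpen_core {O : Set (Hedgehog F)} (hO : IsOpen O) : IsOpen (core O) := by
  refine isOpen_iff.2 ⟨fun i ↦ ?_, fun i hi ↦ ⟨fun j ↦ ?_, ?_⟩⟩
  · rw [isOpen_iff_eventually]
    intro t ht
    -- Compactness of `I` makes the condition on all `s` open in `t`.
    have := isCompact_univ.eventually_forall_of_forall_eventually (x₀ := t)
      (P := fun (t s : I) ↦ mk (F := F) i (s * t) ∈ O) fun s _ ↦
        ((hO.preimage (continuous_mk i)).preimage
          (show Continuous fun z : I × I ↦ z.2 * z.1 by fun_prop)).mem_nhds (ht s)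
    filter_upwards [this] with t' ht' s using ht' s trivial
  · intro s
    simpa using ((isOpen_iff.1 hO).2 i (by simpa [mk_mem_core] using hi 0)).1 j
  · have := ((isOpen_iff.1 hO).2 i (by simpa [mk_mem_core] using hi 0)).2
    exact this.mono fun j hj t s ↦ hj _

/-- Multiplication of the coordinates along the spines. -/
def scale (z : I × Hedgehog F) : Hedgehog F := mk (F := F) z.2.spine (z.1 * z.2.coord)

theorem scale_mk (s : I) (i : ι) (t : I) : scale (s, mk (F := F) i t) = mk (F := F) i (s * t) := rfl

theorem continuous_scale : Continuous (scale : I × Hedgehog F → Hedgehog F) := by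
  refine ⟨fun O hO ↦ isOpen_iff_mem_nhds.2 ?_⟩
  rintro ⟨s, y⟩
  cases y with | mk i t =>
  intro hmem
  rw [mem_preimage, scale_mk] at hmem
  by_cases ht : t = 0
  · subst ht
    rw [mul_zero] at hmem
    refine mem_of_superset (prod_mem_nhds univ_mem ((isOpen_core hO).mem_nhds
      (mk_mem_core.2 fun s ↦ (by simpa using hmem)))) ?_
    rintro ⟨s', y⟩ ⟨-, hy⟩
    exact hy s'
  · have hO' : IsOpen {z : I × I | mk (F := F) i (z.1 * z.2) ∈ O} :=
      (hO.preimage (continuous_mk i)).preimage (by fun_prop)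
    obtain ⟨A, hA, B, hB, hAB⟩ := mem_nhds_prod_iff.1 (hO'.mem_nhds (x := (s, t)) hmem)
    obtain ⟨B', hB'B, hB', htB'⟩ := mem_nhds_iff.1 hB
    refine mem_of_superset (prod_mem_nhds hA ((isOpen_image_mk (F := F) (i := i)
      (hB'.inter (isOpen_compl_singleton (x := (0 : I)))) (by simp)).mem_nhds
      ⟨t, ⟨htB', ht⟩, rfl⟩)) ?_
    rintro ⟨s', y⟩ ⟨hs', t', ⟨ht', -⟩, rfl⟩
    exact hAB (mk_mem_prod hs' (hB'B ht'))

instance [Nonempty ι] : ContractibleSpace (Hedgehog F) := by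
  classical
  obtain ⟨i₀⟩ := ‹Nonempty ι›
  rw [contractible_iff_id_nullhomotopic]
  -- `scale (0, y)` still depends on the spine of `y`, but is inseparable from `mk i₀ 0`; replacing
  -- it keeps continuity.
  refine ⟨mk (F := F) i₀ 0, ContinuousMap.Homotopic.symm
    ⟨⟨⟨fun z ↦ if z.1 = 0 then mk i₀ 0 else scale z, ⟨fun O hO ↦ ?_⟩⟩, fun y ↦ ?_, fun y ↦ ?_⟩⟩⟩
  · convert hO.preimage continuous_scale using 1
    ext ⟨s, y⟩
    cases y with | mk i t =>
    by_cases hs : s = 0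
    · simpa [hs, scale_mk] using (inseparable_mk_zero i₀ i).mem_open_iff hO
    · simp [hs]
  · simp
  · cases y with | mk i t =>
    simp [scale_mk]

instance : LocallyPathConnectedSpace (Hedgehog F) := by
  rw [locallyPathConnectedSpace_iff_pathComponentIn_mem_nhds]
  intro y O hO
  cases y with | mk i t =>
  intro hy
  by_cases ht : t = 0
  · subst ht
    refine mem_of_superset ((isOpen_core hO).mem_nhds
      (mk_mem_core.2 fun s ↦ (by simpa using hy))) fun y ↦ ?_
    cases y with | mk j t =>
    intro hj
    have hj0 : mk (F := F) j 0 ∈ O := by simpa using hj 0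
    refine ((inseparable_mk_zero i j).joinedIn hy hj0).trans
      ⟨⟨⟨fun s ↦ mk (F := F) j (s * t), (continuous_mk j).comp (by fun_prop)⟩, ?_, ?_⟩, hj⟩
    · simp
    · simp
  · let A : Set I := mk (F := F) i ⁻¹' O ∩ {0}ᶜ
    have hA : IsOpen A := (hO.preimage (continuous_mk i)).inter isOpen_compl_singleton
    refine mem_of_superset ((isOpen_image_mk (hA.pathComponentIn t) fun h ↦
      (pathComponentIn_subset h).2 rfl).mem_nhds ⟨t, mem_pathComponentIn_self ⟨hy, ht⟩, rfl⟩) ?_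
    rintro _ ⟨t', ht', rfl⟩
    exact (JoinedIn.map ht' (continuous_mk (F := F) i)).mono (by rintro _ ⟨r, hr, rfl⟩; exact hr.1)

end Hedgehog

/-- If a family of paths issuing from `p e₀` shrinks to `p e₀`, then so do their lifts issuing
from `e₀`. -/
theorem HasUniqueLiftingProperty.eventually_lift_mem {E X : Type u} [TopologicalSpace E]
    [TopologicalSpace X] {p : C(E, X)} (hp : HasUniqueLiftingProperty p) {ι : Type u}
    {F : Filter ι} {e₀ : E} {Γ : ι → C(I, E)} (h0 : ∀ i, Γ i 0 = e₀)
    (h : ∀ U ∈ 𝓝 (p e₀), ∀ᶠ i in F, ∀ t, p (Γ i t) ∈ U) {W : Set E} (hW : W ∈ 𝓝 e₀) :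
    ∀ᶠ i in F, ∀ t, Γ i t ∈ W := by
  rcases isEmpty_or_nonempty ι with hι | ⟨⟨i₀⟩⟩
  · exact .of_forall fun i ↦ hι.elim i
  have : Nonempty ι := ⟨i₀⟩
  let f : C(Hedgehog F, X) := ⟨fun y ↦ p (Γ y.spine y.coord),
    (Hedgehog.continuous_iff (z := p e₀) fun i ↦ congrArg p (h0 i)).2
      ⟨fun i ↦ (p.comp (Γ i)).continuous, h⟩⟩
  obtain ⟨g, ⟨hg₀, hg⟩, -⟩ := hp.existsUnique_lift_of_simplyConnectedSpace f
    (Hedgehog.mk i₀ 0) e₀ (congrArg p (h0 i₀))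
  have hg' (i : ι) (t : I) : p (g (.mk i t)) = p (Γ i t) := DFunLike.congr_fun hg (.mk i t)
  -- The copies of `0` go to inseparable points of one fibre, which coincide.
  have hg0 (i : ι) : g (.mk i 0) = e₀ := by
    rw [← hg₀]
    exact hp.eq_of_specializes ((Hedgehog.inseparable_mk_zero i i₀).map g.continuous).specializes
      (by simp [hg', h0])
  have hgΓ (i : ι) : g.comp ⟨_, Hedgehog.continuous_mk i⟩ = Γ i :=
    hp.path_lift_unique (by simp [hg0, h0]) fun t ↦ hg' i t
  refine (((Hedgehog.continuous_iff hg0).1 g.continuous).2 W hW).mono fun i hi t ↦ ?_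
  rw [← hgΓ]
  exact hi t

/-! ### Monodromy and pieces of paths -/

theorem IsCoveringMap.mem_range_mapOfEq_iff {E X : Type*} [TopologicalSpace E]
    [TopologicalSpace X] {p : C(E, X)} (cov : IsCoveringMap p) {x₀ : X} {e₀ : E} (h : p e₀ = x₀)
    (g : FundamentalGroup X x₀) :
    g ∈ (FundamentalGroup.mapOfEq p h).range ↔
      cov.monodromy (x := x₀) (y := x₀) g ⟨e₀, h⟩ = ⟨e₀, h⟩ := by
  constructor
  · rintro ⟨a, rfl⟩
    refine cov.monodromy_eq_of_map_eq (ex := ⟨e₀, h⟩) (ey := ⟨e₀, h⟩) a ?_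
    rw [FundamentalGroup.mapOfEq_apply]
    exact ((Path.Homotopic.Quotient.cast_cast ..).trans
      (Path.Homotopic.Quotient.cast_rfl_rfl _)).symm
  · intro hg
    refine ⟨(cov.liftPathQuotient (x := x₀) (y := x₀) g ⟨e₀, h⟩).cast rfl (congrArg Subtype.val hg).symm, ?_⟩
    rw [FundamentalGroup.mapOfEq_apply, Path.Homotopic.Quotient.map_cast]
    erw [IsCoveringMap.map_liftPathQuotient]
    exact (Path.Homotopic.Quotient.cast_cast ..).trans
      ((Path.Homotopic.Quotient.cast_cast ..).trans (Path.Homotopic.Quotient.cast_rfl_rfl _))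

theorem Path.Homotopic.Quotient.symm_trans_rev {X : Type*} [TopologicalSpace X] {x y z : X}
    (a : Path.Homotopic.Quotient x y) (b : Path.Homotopic.Quotient y z) :
    (a.trans b).symm = b.symm.trans a.symm := by
  induction a with | mk a =>
  induction b with | mk b =>
  rw [← mk_trans, ← mk_symm, Path.trans_symm]
  rfl

namespace Path

variable {X : Type*} [TopologicalSpace X] {x y : X}

/-- The part of a path up to time `t`. -/
noncomputable def initial (γ : Path x y) (t : I) : Path x (γ t) :=
  (γ.subpath 0 t).cast γ.source.symm rfl

theorem initial_zero_apply (γ : Path x y) (s : I) : γ.initial 0 s = x := by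
  simp [initial]

theorem initial_one_apply (γ : Path x y) (s : I) : γ.initial 1 s = γ s := by
  simp [initial]

theorem mk_initial_trans_mk_subpath (γ : Path x y) (s t : I) :
    (Homotopic.Quotient.mk (γ.initial s)).trans (.mk (γ.subpath s t)) = .mk (γ.initial t) := by
  obtain ⟨H⟩ : Nonempty (((γ.subpath 0 s).trans (γ.subpath s t)).Homotopy (γ.subpath 0 t)) :=
    ⟨Homotopy.subpathTransSubpath γ 0 s t⟩
  exact Homotopic.Quotient.eq.2 (Homotopic.pathCast ⟨H⟩ γ.source.symm rfl)

theorem eventually_range_subpath_subset (γ : Path x y) (t : I) {U : Set X} (hU : U ∈ 𝓝 (γ t)) :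
    ∀ᶠ s in 𝓝 t, range (γ.subpath t s) ⊆ U := by
  have : ∀ᶠ s in 𝓝 t, ∀ r : I, γ.subpath t s r ∈ U := by
    have := isCompact_univ.eventually_forall_of_forall_eventually (x₀ := t)
      (P := fun (s r : I) ↦ γ.subpath t s r ∈ U) fun r _ ↦ by
        have hc : Continuous fun z : I × I ↦ γ.subpath t z.1 z.2 :=
          γ.subpath_continuous_family.comp (continuous_const.prodMk continuous_id)
        refine hc.continuousAt.preimage_mem_nhds ?_
        simpa using hU
    filter_upwards [this] with s hs r using hs r trivial
  filter_upwards [this] with s hs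
  exact range_subset_iff.2 hs

end Path

/-- The normal core lies in every conjugate of `K`, that is, in every stabilizer of a coset. -/
theorem QuotientGroup.smul_eq_of_mem_normalCore {G : Type*} [Group G] {K : Subgroup G} {n : G}
    (hn : n ∈ K.normalCore) (v : G ⧸ K) : n • v = v := by
  induction v using QuotientGroup.induction_on with | H g =>
  refine (QuotientGroup.eq.2 ?_ : ((n * g : G) : G ⧸ K) = g)
  simpa [mul_assoc] using inv_mem hn g⁻¹

/-! ### Local transport and the covering space of a subgroup -/

/-- An open cover of `X` by neighbourhoods of its points, and for each of its members a choice of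
paths from `x₀` to the points that is compatible, up to the normal core of `K`, with the motion
along paths inside of the member. -/
structure LocalTransport {X : Type u} [TopologicalSpace X] {x₀ : X}
    (K : Subgroup (FundamentalGroup X x₀)) where
  /-- The members of the cover. -/
  nhd : X → Set X
  isOpen_nhd : ∀ i, IsOpen (nhd i)
  mem_nhd : ∀ i, i ∈ nhd i
  /-- The paths to the points. -/
  path : X → ∀ y, Path.Homotopic.Quotient x₀ y
  path_trans_mem : ∀ (i y y' : X) (δ : Path y y'), range δ ⊆ nhd i →
    ((path i y).trans (.mk δ)).trans (path i y').symm ∈ K.normalCore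

theorem exists_localTransport {X : Type u} [TopologicalSpace X] [ConnectedSpace X]
    [LocallyPathConnectedSpace X] {x₀ : X} {K : Subgroup (FundamentalGroup X x₀)}
    (hK : ∀ x, ∃ V ∈ 𝓝 x, ∀ (α : Path x₀ x) (β : Path x x), range β ⊆ V →
      FundamentalGroup.fromPath (.mk ((α.trans β).trans α.symm)) ∈ K) :
    Nonempty (LocalTransport K) := by
  classical
  have : PathConnectedSpace X := .of_locallyPathConnectedSpace
  choose V hV hVK using hK
  have hVN (x : X) (α : Path x₀ x) (β : Path x x) (hβ : range β ⊆ V x) :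
      FundamentalGroup.fromPath (.mk ((α.trans β).trans α.symm)) ∈ K.normalCore := by
    -- Conjugation by `g` only changes `α`, which is arbitrary.
    intro g
    obtain ⟨γ, rfl⟩ := Path.Homotopic.Quotient.mk_surjective g
    convert hVK x (γ.symm.trans α) β hβ using 1
    simp only [FundamentalGroup.mul_def, FundamentalGroup.inv_def, FundamentalGroup.fromPath,
      FundamentalGroup.fromArrow, Path.Homotopic.Quotient.mk_trans,
      Path.Homotopic.Quotient.mk_symm, Path.trans_symm, Path.symm_symm]
    grind
  let a (i : X) : Path x₀ i := PathConnectedSpace.somePath x₀ i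
  let B (i : X) : Set X := pathComponentIn (interior (V i)) i
  have hBV (i : X) : B i ⊆ V i := pathComponentIn_subset.trans interior_subset
  -- Outside `B i` the path is a default value that is never used.
  have hB (i y : X) : ∃ δ : Path i y, y ∈ B i → range δ ⊆ V i := by
    by_cases hy : y ∈ B i
    · exact ⟨hy.somePath, fun _ ↦
        range_subset_iff.2 fun t ↦ interior_subset (hy.somePath_mem t)⟩
    · exact ⟨PathConnectedSpace.somePath i y, fun h ↦ absurd h hy⟩
  choose d hd using hB
  refine ⟨⟨B, fun i ↦ isOpen_interior.pathComponentIn i,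
    fun i ↦ mem_pathComponentIn_self (mem_interior_iff_mem_nhds.2 (hV i)),
    fun i y ↦ (Path.Homotopic.Quotient.mk (a i)).trans (.mk (d i y)), fun i y y' δ hδ ↦ ?_⟩⟩
  have hy := hd i y (hδ ⟨0, δ.source⟩)
  have hy' := hd i y' (hδ ⟨1, δ.target⟩)
  have hrange : range (((d i y).trans δ).trans (d i y').symm) ⊆ V i := by
    rw [Path.trans_range, Path.trans_range, Path.symm_range]
    exact union_subset (union_subset hy (hδ.trans (hBV i))) hy'
  convert hVN i (a i) _ hrange using 1
  · rfl
  · simp only [FundamentalGroup.fromPath, FundamentalGroup.fromArrow,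
      Path.Homotopic.Quotient.mk_trans, Path.Homotopic.Quotient.mk_symm,
      Path.Homotopic.Quotient.symm_trans_rev, Path.Homotopic.Quotient.trans_assoc]

noncomputable section

namespace LocalTransport

variable {X : Type u} [TopologicalSpace X] {x₀ : X} {K : Subgroup (FundamentalGroup X x₀)}

/-- The sheets of the covering space: the cosets of `K`, with the discrete topology. -/
def Sheet (K : Subgroup (FundamentalGroup X x₀)) : Type u := FundamentalGroup X x₀ ⧸ K

instance : TopologicalSpace (Sheet K) := ⊥

instance : DiscreteTopology (Sheet K) := ⟨rfl⟩

instance : MulAction (FundamentalGroup X x₀) (Sheet K) :=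
  inferInstanceAs (MulAction (FundamentalGroup X x₀) (FundamentalGroup X x₀ ⧸ K))

/-- The sheet that contains a homotopy class. -/
def sheet (K : Subgroup (FundamentalGroup X x₀)) (g : FundamentalGroup X x₀) : Sheet K :=
  (g : FundamentalGroup X x₀ ⧸ K)

theorem sheet_surjective : Function.Surjective (sheet K) := QuotientGroup.mk_surjective

theorem sheet_eq_iff {g h : FundamentalGroup X x₀} : sheet K g = sheet K h ↔ g⁻¹ * h ∈ K :=
  QuotientGroup.eq

theorem smul_sheet (g h : FundamentalGroup X x₀) : g • sheet K h = sheet K (h.trans g) := rfl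

theorem smul_eq_of_mem_normalCore {n : FundamentalGroup X x₀} (hn : n ∈ K.normalCore)
    (v : Sheet K) : n • v = v :=
  QuotientGroup.smul_eq_of_mem_normalCore hn v

variable (T : LocalTransport K)

/-- The loops that relate the paths to `y` chosen for two members of the cover. -/
def cocycle (i j y : X) : FundamentalGroup X x₀ := (T.path i y).trans (T.path j y).symm

/-- Moving along `δ` changes the cocycle only by elements of the normal core, which fix all sheets.
So coordinate changes are locally constant. -/
theorem cocycle_smul_eq {i j y y' : X} (δ : Path y y') (hδ : range δ ⊆ T.nhd i ∩ T.nhd j)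
    (v : Sheet K) : T.cocycle i j y' • v = T.cocycle i j y • v := by
  have hi := T.path_trans_mem i y y' δ (hδ.trans inter_subset_left)
  have hj := T.path_trans_mem j y y' δ (hδ.trans inter_subset_right)
  set m : FundamentalGroup X x₀ := ((T.path i y).trans (.mk δ)).trans (T.path i y').symm with hm
  set n : FundamentalGroup X x₀ := ((T.path j y).trans (.mk δ)).trans (T.path j y').symm with hn
  have : T.cocycle i j y' * m = n * T.cocycle i j y := by
    simp only [cocycle, FundamentalGroup.mul_def, hm, hn]
    grind
  calc T.cocycle i j y' • v = (T.cocycle i j y' * m) • v := by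
        rw [mul_smul, smul_eq_of_mem_normalCore hi]
    _ = T.cocycle i j y • v := by rw [this, mul_smul, smul_eq_of_mem_normalCore hj]

theorem cocycle_self (i y : X) : T.cocycle i i y = 1 :=
  Path.Homotopic.Quotient.trans_symm _

theorem cocycle_mul (i j k y : X) : T.cocycle j k y * T.cocycle i j y = T.cocycle i k y := by
  simp only [cocycle, FundamentalGroup.mul_def]
  grind

variable [LocallyPathConnectedSpace X]

/-- The covering space of `X` that belongs to `K`, as a fibre bundle. -/
def core : FiberBundleCore X X (Sheet K) where
  baseSet := T.nhd
  isOpen_baseSet := T.isOpen_nhd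
  indexAt := id
  mem_baseSet_at := T.mem_nhd
  coordChange i j y v := T.cocycle i j y • v
  coordChange_self i y _ v := by rw [cocycle_self, one_smul]
  continuousOn_coordChange i j := by
    rintro ⟨y, v⟩ ⟨hy, -⟩
    have hU : IsOpen (T.nhd i ∩ T.nhd j) := (T.isOpen_nhd i).inter (T.isOpen_nhd j)
    refine (ContinuousAt.congr (continuousAt_const (y := T.cocycle i j y • v))
      ?_).continuousWithinAt
    filter_upwards [prod_mem_nhds ((hU.pathComponentIn y).mem_nhds (mem_pathComponentIn_self hy))
      ((isOpen_discrete {v}).mem_nhds rfl)]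
    rintro ⟨y', _⟩ ⟨⟨δ, hδ⟩, rfl⟩
    exact (T.cocycle_smul_eq δ (range_subset_iff.2 hδ) _).symm
  coordChange_comp i j k y _ v := by rw [← mul_smul, cocycle_mul]

/-- The point of the covering space that belongs to a class of paths. -/
def point {y : X} (a : Path.Homotopic.Quotient x₀ y) : T.core.TotalSpace :=
  -- The chart at `y` is the member indexed by `y`. Products in `π₁` run from right to left, so a
  -- left coset of `K` absorbs loops of `K` run first.
  ⟨y, sheet K (a.trans (T.path y y).symm)⟩

theorem point_congr {y y' : X} (h : y = y') {α : Path x₀ y} {α' : Path x₀ y'}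
    (hα : ∀ t, α t = α' t) : T.point (.mk α) = T.point (.mk α') := by
  subst h
  rw [Path.ext (funext hα)]

theorem exists_point_eq (e : T.core.TotalSpace) : ∃ γ : Path x₀ e.1, T.point (.mk γ) = e := by
  obtain ⟨y, v⟩ := e
  obtain ⟨g, rfl⟩ := sheet_surjective (K := K) v
  obtain ⟨γ, hγ⟩ := Path.Homotopic.Quotient.mk_surjective
    (Path.Homotopic.Quotient.trans g (T.path y y))
  refine ⟨γ, ?_⟩
  simp only [point, hγ]
  congr 1
  grind

theorem continuous_point_initial {y : X} (γ : Path x₀ y) :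
    Continuous fun t ↦ T.point (.mk (γ.initial t)) := by
  refine continuous_iff_continuousAt.2 fun t ↦ ?_
  rw [FiberBundle.continuousAt_totalSpace]
  refine ⟨γ.continuous.continuousAt, ?_⟩
  refine ContinuousAt.congr (continuousAt_const
    (y := sheet K ((Path.Homotopic.Quotient.mk (γ.initial t)).trans (T.path (γ t) (γ t)).symm))) ?_
  filter_upwards [γ.eventually_range_subpath_subset t
    ((T.isOpen_nhd _).mem_nhds (T.mem_nhd (γ t)))] with s hs
  change _ = T.cocycle (γ s) (γ t) (γ s) • sheet K
    ((Path.Homotopic.Quotient.mk (γ.initial s)).trans (T.path (γ s) (γ s)).symm)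
  -- The transport from `t` to `s` fixes every sheet; inserted, it turns the coordinate at `t` into
  -- the one at `s`.
  rw [← smul_eq_of_mem_normalCore (T.path_trans_mem _ _ _ _ hs) (sheet K _), smul_sheet,
    smul_sheet, ← γ.mk_initial_trans_mk_subpath t s, cocycle]
  congr 1
  grind

/-- The lift of a path issuing from `x₀` to the covering space. -/
def lift {y : X} (γ : Path x₀ y) :
    Path (T.point (.refl x₀)) (T.point (.mk γ)) where
  toFun t := T.point (.mk (γ.initial t))
  continuous_toFun := T.continuous_point_initial γ
  source' := T.point_congr γ.source (α' := .refl x₀) γ.initial_zero_apply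
  target' := T.point_congr γ.target γ.initial_one_apply

theorem isCoveringMap_proj : IsCoveringMap T.core.proj :=
  FiberBundle.isCoveringMap

theorem pathConnectedSpace : PathConnectedSpace T.core.TotalSpace := by
  have (e : T.core.TotalSpace) : Joined (T.point (.refl x₀)) e := by
    obtain ⟨γ, hγ⟩ := T.exists_point_eq e
    exact hγ ▸ ⟨T.lift γ⟩
  exact ⟨⟨T.point (.refl x₀)⟩, fun e e' ↦ (this e).symm.trans (this e')⟩

theorem point_eq_point_refl_iff (g : FundamentalGroup X x₀) :
    T.point (y := x₀) g = T.point (.refl x₀) ↔ g ∈ K := by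
  set u : FundamentalGroup X x₀ := (T.path x₀ x₀).symm with hu
  have h1 : T.point (y := x₀) g = ⟨x₀, sheet K (u * g)⟩ := rfl
  have h2 : T.point (.refl x₀) = ⟨x₀, sheet K (u * 1)⟩ := rfl
  rw [h1, h2]
  have : (⟨x₀, sheet K (u * g)⟩ : T.core.TotalSpace) = ⟨x₀, sheet K (u * 1)⟩ ↔
      sheet K (u * g) = sheet K (u * 1) :=
    ⟨fun h ↦ eq_of_heq (Bundle.TotalSpace.mk.inj h).2, fun h ↦ congrArg _ h⟩
  rw [this, sheet_eq_iff, mul_one, mul_inv_rev, inv_mul_cancel_right, inv_mem_iff]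

theorem isCoveringSubgroup (T : LocalTransport K) : IsCoveringSubgroup K := by
  have := T.pathConnectedSpace
  let p : C(T.core.TotalSpace, X) := ⟨T.core.proj, T.isCoveringMap_proj.continuous⟩
  have cov : IsCoveringMap p := T.isCoveringMap_proj
  have hp : p (T.point (.refl x₀)) = x₀ := rfl
  refine ⟨T.core.TotalSpace, inferInstance, p, T.point (.refl x₀), hp, inferInstance, cov, ?_⟩
  ext g
  refine (cov.mem_range_mapOfEq_iff hp g).trans (Iff.trans ?_ (T.point_eq_point_refl_iff g))
  obtain ⟨γ, rfl⟩ := Path.Homotopic.Quotient.mk_surjective g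
  have : cov.monodromy (.mk γ) ⟨T.point (.refl x₀), hp⟩ = ⟨T.point (.mk γ), rfl⟩ :=
    cov.monodromy_eq_of_map_eq (.mk (T.lift γ)) rfl
  exact this ▸ Subtype.ext_iff

end LocalTransport

end

/-! ### Small loops and generalized covering subgroups -/

theorem FundamentalGroup.map_eq_mapOfEq {X Y : Type*} [TopologicalSpace X] [TopologicalSpace Y]
    (f : C(X, Y)) (x : X) : FundamentalGroup.map f x = FundamentalGroup.mapOfEq f rfl :=
  MonoidHom.ext fun a ↦ by
    rw [mapOfEq_apply]
    exact (Path.Homotopic.Quotient.cast_rfl_rfl _).symm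

theorem FundamentalGroup.mk_mem_range_mapOfEq_iff {X Y : Type*} [TopologicalSpace X]
    [TopologicalSpace Y] (f : C(X, Y)) {x : X} {y : Y} (h : f x = y) (γ : Path y y) :
    fromPath (.mk γ) ∈ (mapOfEq f h).range ↔
      ∃ β : Path x x, ((β.map f.continuous).cast h.symm h.symm).Homotopic γ := by
  constructor
  · rintro ⟨b, hb⟩
    obtain ⟨β, rfl⟩ := Path.Homotopic.Quotient.mk_surjective b
    rw [mapOfEq_apply] at hb
    exact ⟨β, Path.Homotopic.Quotient.exact hb⟩
  · rintro ⟨β, hβ⟩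
    refine ⟨fromPath (.mk β), ?_⟩
    rw [mapOfEq_apply]
    exact Path.Homotopic.Quotient.eq.2 hβ

/-- The subgroup of the classes of the loops in a set. -/
def smallLoopSubgroup {X : Type*} [TopologicalSpace X] {x₀ : X} {U : Set X} (hU : x₀ ∈ U) :
    Subgroup (FundamentalGroup X x₀) where
  carrier := {g | ∃ γ : Path x₀ x₀, range γ ⊆ U ∧ FundamentalGroup.fromPath (.mk γ) = g}
  mul_mem' := by
    rintro _ _ ⟨γ, hγ, rfl⟩ ⟨γ', hγ', rfl⟩
    exact ⟨γ'.trans γ, by rw [Path.trans_range]; exact union_subset hγ' hγ, rfl⟩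
  one_mem' := ⟨.refl x₀, by simpa using hU, rfl⟩
  inv_mem' := by
    rintro _ ⟨γ, hγ, rfl⟩
    exact ⟨γ.symm, by rwa [Path.symm_range], rfl⟩

theorem mk_mem_smallLoopSubgroup {X : Type*} [TopologicalSpace X] {x₀ : X} {U : Set X}
    (hU : x₀ ∈ U) {γ : Path x₀ x₀} (hγ : range γ ⊆ U) :
    FundamentalGroup.fromPath (.mk γ) ∈ smallLoopSubgroup hU :=
  ⟨γ, hγ, rfl⟩

namespace IsStrongSLTAt

variable {X : Type u} [TopologicalSpace X] {x₀ : X}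

theorem isCoveringSubgroup_of_smallLoopSubgroup_le [ConnectedSpace X]
    [LocallyPathConnectedSpace X] (hX : IsStrongSLTAt x₀) {U : Set X} (hU : U ∈ 𝓝 x₀)
    {K : Subgroup (FundamentalGroup X x₀)} (hK : smallLoopSubgroup (mem_of_mem_nhds hU) ≤ K) :
    IsCoveringSubgroup K := by
  obtain ⟨T⟩ := exists_localTransport (K := K) fun x ↦ by
    obtain ⟨V, hV, h⟩ := hX x U hU
    refine ⟨V, hV, fun α β hβ ↦ hK ?_⟩
    obtain ⟨γ, hγ, hγαβ⟩ := h α β hβ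
    rw [← Path.Homotopic.Quotient.eq.2 hγαβ]
    exact mk_mem_smallLoopSubgroup _ hγ
  exact T.isCoveringSubgroup

/-- Strong SLT at the point `x₀` itself makes conjugates of loops in `V` homotopic to loops in `U`.
-/
theorem exists_normalClosure_le (hX : IsStrongSLTAt x₀) {U : Set X} (hU : U ∈ 𝓝 x₀) :
    ∃ V, ∃ hV : V ∈ 𝓝 x₀, Subgroup.normalClosure
      (smallLoopSubgroup (mem_of_mem_nhds hV) : Set (FundamentalGroup X x₀)) ≤
        smallLoopSubgroup (mem_of_mem_nhds hU) := by
  obtain ⟨V, hV, h⟩ := hX x₀ U hU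
  refine ⟨V, hV, (Subgroup.closure_le _).2 fun g hg ↦ ?_⟩
  obtain ⟨_, ⟨β, hβ, rfl⟩, hg⟩ := Group.mem_conjugatesOfSet_iff.1 hg
  obtain ⟨c, rfl⟩ := isConj_iff.1 hg
  obtain ⟨α, rfl⟩ := Path.Homotopic.Quotient.mk_surjective c
  obtain ⟨γ, hγ, hγαβ⟩ := h α.symm β hβ
  refine ⟨γ, hγ, ?_⟩
  rw [Path.Homotopic.Quotient.eq.2 hγαβ]
  simp only [FundamentalGroup.mul_def, FundamentalGroup.inv_def, FundamentalGroup.fromPath,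
    FundamentalGroup.fromArrow, Path.Homotopic.Quotient.mk_trans,
    Path.Homotopic.Quotient.mk_symm, Path.symm_symm]
  grind

/-- An element of all the covering subgroups that contain `H` differs from an element of `H` by an
arbitrarily small loop. -/
theorem exists_mul_eq_of_mem_sInf [ConnectedSpace X] [LocallyPathConnectedSpace X]
    (hX : IsStrongSLTAt x₀) {H : Subgroup (FundamentalGroup X x₀)} {g : FundamentalGroup X x₀}
    (hg : g ∈ sInf {K : Subgroup (FundamentalGroup X x₀) | IsCoveringSubgroup K ∧ H ≤ K})
    {U : Set X} (hU : U ∈ 𝓝 x₀) :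
    ∃ n ∈ smallLoopSubgroup (mem_of_mem_nhds hU), ∃ h ∈ H, n * h = g := by
  obtain ⟨V, hV, hVU⟩ := hX.exists_normalClosure_le hU
  -- The join with `H` contains the loops in `V`, so it is a covering subgroup; by normality it is a
  -- product set.
  have := Subgroup.mem_sInf.1 hg (Subgroup.normalClosure (smallLoopSubgroup (mem_of_mem_nhds hV) :
    Set (FundamentalGroup X x₀)) ⊔ H) ⟨hX.isCoveringSubgroup_of_smallLoopSubgroup_le hV
      (Subgroup.subset_normalClosure.trans (SetLike.coe_subset_coe.2 le_sup_left)), le_sup_right⟩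
  obtain ⟨n, hn, h, hh, rfl⟩ := (Subgroup.mem_sup_of_normal_left ..).1 this
  exact ⟨n, hVU hn, h, hh, rfl⟩

theorem sInf_le_of_isGeneralizedCoveringSubgroup [ConnectedSpace X] [LocallyPathConnectedSpace X]
    (hX : IsStrongSLTAt x₀) {H : Subgroup (FundamentalGroup X x₀)}
    (hH : IsGeneralizedCoveringSubgroup H) :
    sInf {K : Subgroup (FundamentalGroup X x₀) | IsCoveringSubgroup K ∧ H ≤ K} ≤ H := by
  obtain ⟨E, _, p, e₀, rfl, ⟨-, -, hp⟩, rfl⟩ := hH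
  intro g hg
  obtain ⟨γ, rfl⟩ := Path.Homotopic.Quotient.mk_surjective g
  obtain ⟨Γ, hΓ₀, hΓ⟩ := hp.exists_path_lift γ rfl
  have key (U : {U : Set X // U ∈ 𝓝 (p e₀)}) :
      ∃ N : C(I, E), N 0 = e₀ ∧ N 1 = Γ 1 ∧ ∀ t, p (N t) ∈ U.1 := by
    obtain ⟨_, ⟨n, hnU, rfl⟩, h, hh, hnh⟩ := hX.exists_mul_eq_of_mem_sInf hg U.2
    obtain ⟨_, rfl⟩ := Path.Homotopic.Quotient.mk_surjective h
    obtain ⟨η, hη⟩ := (FundamentalGroup.mk_mem_range_mapOfEq_iff p rfl _).1 hh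
    rw [← Path.Homotopic.Quotient.eq.2 hη] at hnh
    obtain ⟨N, hN₀, hN⟩ := hp.exists_path_lift n rfl
    refine ⟨N, hN₀, ?_, fun t ↦ hN t ▸ hnU (mem_range_self t)⟩
    let N' : Path e₀ (N 1) := ⟨N, hN₀, rfl⟩
    -- `n * h` runs through `h` first, which lifts to the loop `η` at `e₀`; then `N` follows.
    have := hp.lift_one_eq_of_homotopic (Γ := (η.trans N' : C(I, E))) (Γ' := Γ)
      (Path.Homotopic.Quotient.exact hnh) (fun t ↦ ?_) hΓ (by simp [hΓ₀])
    · simpa using this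
    · simp only [ContinuousMap.coe_coe, Path.trans_apply]
      split_ifs
      · rfl
      · exact hN _
  choose N hN₀ hN₁ hN using key
  let F : Filter {U : Set X // U ∈ 𝓝 (p e₀)} := comap Subtype.val (𝓝 (p e₀)).smallSets
  have : F.NeBot := comap_neBot fun t ht ↦ by
    obtain ⟨s, hs, h⟩ := eventually_smallSets.1 ht
    exact ⟨⟨s, hs⟩, h s subset_rfl⟩
  have hspec : Γ 1 ⤳ e₀ := specializes_iff_pure.2 fun W hW ↦ by
    have h := hp.eventually_lift_mem (F := F) hN₀ (fun U hU ↦ ?_) hW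
    · obtain ⟨U, hU⟩ := h.exists
      exact mem_pure.2 (hN₁ U ▸ hU 1)
    · have : ∀ᶠ V : {U : Set X // U ∈ 𝓝 (p e₀)} in F, V.1 ⊆ U :=
        (eventually_smallSets_subset.2 hU).comap _
      exact this.mono fun V hV t ↦ hV (hN V t)
  have hΓ₁ : Γ 1 = e₀ := hp.eq_of_specializes hspec (by simp [hΓ])
  refine (FundamentalGroup.mk_mem_range_mapOfEq_iff p rfl γ).2 ⟨⟨Γ, hΓ₀, hΓ₁⟩, ?_⟩
  rw [show (Path.map ⟨Γ, hΓ₀, hΓ₁⟩ p.continuous).cast rfl rfl = γ from Path.ext (funext hΓ)]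

end IsStrongSLTAt

/-! ### The locally path connected refinement -/

/-- A space with the topology generated by the path components of its open subsets. -/
@[ext]
structure LocalPathRefinement (Z : Type*) where
  /-- A point of the space, as a point of the refinement. -/
  of ::
  /-- The underlying point of the space. -/
  val : Z

namespace LocalPathRefinement

variable {Y Z : Type*} [TopologicalSpace Y] [TopologicalSpace Z]

instance : TopologicalSpace (LocalPathRefinement Z) :=
  .generateFrom {S | ∃ (U : Set Z) (z : Z), IsOpen U ∧ S = val ⁻¹' pathComponentIn U z}

theorem isOpen_preimage_pathComponentIn {U : Set Z} (hU : IsOpen U) (z : Z) :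
    IsOpen (val ⁻¹' pathComponentIn U z : Set (LocalPathRefinement Z)) :=
  TopologicalSpace.isOpen_generateFrom_of_mem ⟨U, z, hU, rfl⟩

theorem continuous_val : Continuous (val : LocalPathRefinement Z → Z) :=
  ⟨fun _ hU ↦ isOpen_iff_mem_nhds.2 fun z hz ↦
    mem_of_superset ((isOpen_preimage_pathComponentIn hU (val z)).mem_nhds
      (mem_pathComponentIn_self hz)) (preimage_mono pathComponentIn_subset)⟩

/-- `f` maps a path component of `f ⁻¹' U`, which is open in `Y`, into one path component of `U`. In
particular paths in `Z` stay continuous. -/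
theorem continuous_of_comp [LocallyPathConnectedSpace Y] {f : Y → Z} (hf : Continuous f) :
    Continuous fun y ↦ of (f y) := by
  refine continuous_generateFrom_iff.2 ?_
  rintro _ ⟨U, z, hU, rfl⟩
  refine isOpen_iff_mem_nhds.2 fun y hy ↦ ?_
  have hy' : f y ∈ pathComponentIn U z := hy
  have hyU : f y ∈ U := pathComponentIn_subset hy'
  refine mem_of_superset (((hU.preimage hf).pathComponentIn y).mem_nhds
    (mem_pathComponentIn_self hyU)) fun y' h ↦ ?_
  change f y' ∈ pathComponentIn U z
  rw [← pathComponentIn_congr hy']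
  exact (JoinedIn.map h hf).mono (image_preimage_subset _ _)

theorem exists_pathComponentIn_subset {S : Set (LocalPathRefinement Z)} (hS : IsOpen S)
    {z : LocalPathRefinement Z} (hz : z ∈ S) :
    ∃ U : Set Z, IsOpen U ∧ val z ∈ U ∧ val ⁻¹' pathComponentIn U (val z) ⊆ S := by
  induction hS with
  | basic S h =>
    obtain ⟨U, w, hU, rfl⟩ := h
    refine ⟨U, hU, pathComponentIn_subset hz, ?_⟩
    rw [pathComponentIn_congr (show val z ∈ pathComponentIn U w from hz)]
  | univ => exact ⟨univ, isOpen_univ, trivial, subset_univ _⟩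
  | inter S S' _ _ ih ih' =>
    obtain ⟨U, hU, hzU, h⟩ := ih hz.1
    obtain ⟨U', hU', hzU', h'⟩ := ih' hz.2
    exact ⟨U ∩ U', hU.inter hU', ⟨hzU, hzU'⟩, subset_inter
      ((preimage_mono (pathComponentIn_mono inter_subset_left)).trans h)
      ((preimage_mono (pathComponentIn_mono inter_subset_right)).trans h')⟩
  | sUnion 𝒮 _ ih =>
    obtain ⟨S, hS, hzS⟩ := hz
    obtain ⟨U, hU, hzU, h⟩ := ih S hS hzS
    exact ⟨U, hU, hzU, h.trans (subset_sUnion_of_mem hS)⟩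

instance : LocallyPathConnectedSpace (LocalPathRefinement Z) := by
  rw [locallyPathConnectedSpace_iff_pathComponentIn_mem_nhds]
  intro z S hS hz
  obtain ⟨U, hU, hzU, h⟩ := exists_pathComponentIn_subset hS hz
  refine mem_of_superset ((isOpen_preimage_pathComponentIn hU (val z)).mem_nhds
    (mem_pathComponentIn_self hzU)) fun w hw ↦ ?_
  -- The path must stay in the component, not only in `U`, to remain in `S`.
  have hw' : JoinedIn (pathComponentIn U (val z)) (val z) (val w) :=
    (isPathConnected_pathComponentIn hzU).joinedIn _ (mem_pathComponentIn_self hzU) _ hw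
  obtain ⟨δ, hδ⟩ := hw'
  exact ⟨⟨⟨fun t ↦ of (δ t), continuous_of_comp δ.continuous⟩, LocalPathRefinement.ext δ.source,
    LocalPathRefinement.ext δ.target⟩, fun t ↦ h (hδ t)⟩

end LocalPathRefinement

/-! ### Fibre products of coverings -/

section FiberProduct

variable {X : Type u} [TopologicalSpace X] {ι : Type u} {E : ι → Type u}
  [∀ i, TopologicalSpace (E i)] (p : ∀ i, C(E i, X))

/-- The fibre product over `X` of a family of spaces over `X`. -/
def FiberProduct : Type u := {z : X × ∀ i, E i // ∀ i, p i (z.2 i) = z.1}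

instance : TopologicalSpace (FiberProduct p) :=
  inferInstanceAs (TopologicalSpace {z : X × ∀ i, E i // ∀ i, p i (z.2 i) = z.1})

variable {p}

/-- The path component of a point in the locally path connected refinement of the fibre product. -/
def FiberProductComponent (q₀ : FiberProduct p) : Type u :=
  pathComponent (LocalPathRefinement.of q₀)

namespace FiberProductComponent

variable {q₀ : FiberProduct p}

instance : TopologicalSpace (FiberProductComponent q₀) :=
  inferInstanceAs (TopologicalSpace (pathComponent (LocalPathRefinement.of q₀)))

instance : LocallyPathConnectedSpace (FiberProductComponent q₀) :=
  (IsOpen.pathComponent (LocalPathRefinement.of q₀)).locallyPathConnectedSpace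

instance : PathConnectedSpace (FiberProductComponent q₀) :=
  isPathConnected_iff_pathConnectedSpace.1
    (isPathConnected_pathComponent (x := LocalPathRefinement.of q₀))

/-- The underlying point of the fibre product. -/
def val (e : FiberProductComponent q₀) : FiberProduct p := e.1.val

theorem continuous_val : Continuous (val : FiberProductComponent q₀ → FiberProduct p) :=
  LocalPathRefinement.continuous_val.comp continuous_subtype_val

variable (q₀) in
/-- The projection to the base. -/
def proj : C(FiberProductComponent q₀, X) :=
  ⟨fun e ↦ e.val.1.1, continuous_fst.comp (continuous_subtype_val.comp continuous_val)⟩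

variable (q₀) in
/-- The projection to a factor. -/
def coord (i : ι) : C(FiberProductComponent q₀, E i) :=
  ⟨fun e ↦ e.val.1.2 i, (continuous_apply i).comp
    (continuous_snd.comp (continuous_subtype_val.comp continuous_val))⟩

variable (q₀) in
/-- The base point. -/
def base : FiberProductComponent q₀ := ⟨.of q₀, mem_pathComponent_self _⟩

theorem apply_coord (e : FiberProductComponent q₀) (i : ι) : p i (coord q₀ i e) = proj q₀ e :=
  e.val.2 i

theorem ext {e e' : FiberProductComponent q₀} (h : proj q₀ e = proj q₀ e')
    (h' : ∀ i, coord q₀ i e = coord q₀ i e') : e = e' :=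
  Subtype.ext (LocalPathRefinement.ext (Subtype.ext (Prod.ext h (funext h'))))

theorem exists_lift {Y : Type*} [TopologicalSpace Y] [PathConnectedSpace Y]
    [LocallyPathConnectedSpace Y] (f : C(Y, X)) (g : ∀ i, C(Y, E i))
    (h : ∀ i y, p i (g i y) = f y) {y₀ : Y} {e₀ : FiberProductComponent q₀}
    (hf : f y₀ = proj q₀ e₀) (hg : ∀ i, g i y₀ = coord q₀ i e₀) :
    ∃ G : C(Y, FiberProductComponent q₀), (∀ y, proj q₀ (G y) = f y) ∧
      ∀ i y, coord q₀ i (G y) = g i y := by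
  let k (y : Y) : FiberProduct p := ⟨(f y, fun i ↦ g i y), fun i ↦ h i y⟩
  have hk : Continuous k :=
    (f.continuous.prodMk (continuous_pi fun i ↦ (g i).continuous)).subtype_mk _
  have hk' := LocalPathRefinement.continuous_of_comp hk
  have hk₀ : LocalPathRefinement.of (k y₀) = e₀.1 :=
    LocalPathRefinement.ext (Subtype.ext (Prod.ext hf (funext hg)))
  have hmem (y : Y) : LocalPathRefinement.of (k y) ∈ pathComponent (.of q₀) := by
    have : Joined (LocalPathRefinement.of (k y₀)) (.of (k y)) :=
      ⟨(PathConnectedSpace.somePath y₀ y).map hk'⟩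
    rw [hk₀] at this
    exact (show Joined _ _ from e₀.2).trans this
  exact ⟨⟨fun y ↦ ⟨.of (k y), hmem y⟩, hk'.subtype_mk hmem⟩, fun y ↦ rfl, fun i y ↦ rfl⟩

/-- `proj` factors through each `p i`, so the lifting criterion for coverings applies in each
factor; uniqueness is also checked factorwise. -/
theorem hasUniqueLiftingProperty_proj (hp : ∀ i, IsCoveringMap (p i)) :
    HasUniqueLiftingProperty (proj q₀) := by
  intro Y _ _ _ y₀ e₀ f hf hle
  have : PathConnectedSpace Y := .of_locallyPathConnectedSpace
  have hcoord (i : ι) : p i (coord q₀ i e₀) = f y₀ := (apply_coord e₀ i).trans hf.symm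
  have hlift (i : ι) : ∃ g : C(Y, E i), g y₀ = coord q₀ i e₀ ∧ ∀ y, p i (g y) = f y := by
    obtain ⟨g, ⟨h, h'⟩, -⟩ := (hp i).existsUnique_continuousMap_lifts_of_range_le (f := f)
      (hcoord i) (by
        rintro _ ⟨a, rfl⟩
        obtain ⟨α, rfl⟩ := Path.Homotopic.Quotient.mk_surjective a
        have hα : FundamentalGroup.fromPath
            (.mk ((α.map f.continuous).cast hf.symm hf.symm)) ∈
              (FundamentalGroup.mapOfEq (proj q₀) rfl).range := by
          rw [← FundamentalGroup.map_eq_mapOfEq]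
          exact hle ⟨.mk α, FundamentalGroup.mapOfEq_apply ..⟩
        obtain ⟨β, hβ⟩ := (FundamentalGroup.mk_mem_range_mapOfEq_iff ..).1 hα
        refine (FundamentalGroup.mk_mem_range_mapOfEq_iff _ _ (α.map f.continuous)).2
          ⟨β.map (coord q₀ i).continuous, ?_⟩
        convert hβ.pathCast hf hf using 1
        · ext t
          exact apply_coord (β t) i
        · rfl)
    exact ⟨g, h, congrFun h'⟩
  choose g hg₀ hg using hlift
  obtain ⟨G, hG, hG'⟩ := exists_lift f g hg hf hg₀
  refine ⟨G, ⟨ext ((hG _).trans hf) fun i ↦ (hG' i y₀).trans (hg₀ i),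
    ContinuousMap.ext hG⟩, fun G' ⟨hG'₀, hG'f⟩ ↦ ContinuousMap.ext fun y ↦ ?_⟩
  have hG'y (y : Y) : proj q₀ (G' y) = f y := DFunLike.congr_fun hG'f y
  refine ext ((hG'y y).trans (hG y).symm) fun i ↦ congrFun ((hp i).eq_of_comp_eq
    (g₁ := coord q₀ i ∘ G') (g₂ := coord q₀ i ∘ G) ((coord q₀ i).continuous.comp G'.continuous)
    ((coord q₀ i).continuous.comp G.continuous) (funext fun y ↦ ?_) y₀ ?_) y
  · exact (apply_coord _ i).trans ((hG'y y).trans ((apply_coord _ i).trans (hG y)).symm)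
  · exact (congrArg _ hG'₀).trans ((hG' i y₀).trans (hg₀ i)).symm

theorem isGeneralizedCoveringMap_proj (hp : ∀ i, IsCoveringMap (p i)) :
    IsGeneralizedCoveringMap (proj q₀) :=
  ⟨inferInstance, inferInstance, hasUniqueLiftingProperty_proj hp⟩

theorem range_mapOfEq_proj (hp : ∀ i, IsCoveringMap (p i)) :
    (FundamentalGroup.mapOfEq (proj q₀) (x := base q₀) (y := q₀.1.1) rfl).range =
      ⨅ i, (FundamentalGroup.mapOfEq (p i) (q₀.2 i)).range := by
  ext g
  obtain ⟨γ, rfl⟩ := Path.Homotopic.Quotient.mk_surjective g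
  rw [Subgroup.mem_iInf]
  constructor
  · intro hγ i
    obtain ⟨β, hβ⟩ := (FundamentalGroup.mk_mem_range_mapOfEq_iff _ _ γ).1 hγ
    refine (FundamentalGroup.mk_mem_range_mapOfEq_iff _ _ γ).2
      ⟨β.map (coord q₀ i).continuous, ?_⟩
    convert hβ using 1
    ext t
    exact apply_coord (β t) i
  · intro hγ
    have hlift (i : ι) : ∃ Γ : C(I, E i), Γ 0 = q₀.1.2 i ∧ Γ 1 = q₀.1.2 i ∧
        ∀ t, p i (Γ t) = γ t := by
      have h0 : (γ : C(I, X)) 0 = p i (q₀.1.2 i) := γ.source.trans (q₀.2 i).symm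
      exact ⟨(hp i).liftPath γ (q₀.1.2 i) h0, (hp i).liftPath_zero .., congrArg Subtype.val
        (((hp i).mem_range_mapOfEq_iff (q₀.2 i) _).1 (hγ i)), congrFun ((hp i).liftPath_lifts ..)⟩
    choose Γ hΓ₀ hΓ₁ hΓ using hlift
    obtain ⟨G, hG, hG'⟩ := exists_lift (γ : C(I, X)) Γ hΓ (y₀ := 0) (e₀ := base q₀) γ.source hΓ₀
    refine (FundamentalGroup.mk_mem_range_mapOfEq_iff _ _ γ).2 ⟨⟨G,
      ext ((hG 0).trans γ.source) fun i ↦ (hG' i 0).trans (hΓ₀ i),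
      ext ((hG 1).trans γ.target) fun i ↦ (hG' i 1).trans (hΓ₁ i)⟩, ?_⟩
    convert Path.Homotopic.refl γ using 1
    ext t
    exact hG t

end FiberProductComponent

end FiberProduct

/-! ### Intersections of covering subgroups -/

theorem isGeneralizedCoveringSubgroup_iInf {X : Type u} [TopologicalSpace X] {x₀ : X} {ι : Type u}
    {K : ι → Subgroup (FundamentalGroup X x₀)} (hK : ∀ i, IsCoveringSubgroup (K i)) :
    IsGeneralizedCoveringSubgroup (⨅ i, K i) := by
  choose E _ p e h _ hp hpK using hK
  let q₀ : FiberProduct p := ⟨(x₀, e), h⟩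
  refine ⟨_, _, FiberProductComponent.proj q₀, .base q₀, rfl,
    FiberProductComponent.isGeneralizedCoveringMap_proj hp, ?_⟩
  rw [← iInf_congr hpK]
  exact FiberProductComponent.range_mapOfEq_proj hp

theorem mainTheorem6 {X : Type*} [TopologicalSpace X] [ConnectedSpace X]
    [LocallyPathConnectedSpace X] (x₀ : X) (hX : IsStrongSLTAt x₀)
    (H : Subgroup (FundamentalGroup X x₀)) :
    IsGeneralizedCoveringSubgroup H ↔
      H = sInf {K : Subgroup (FundamentalGroup X x₀) | IsCoveringSubgroup K ∧ H ≤ K} := by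
  refine ⟨fun hH ↦ le_antisymm (le_sInf fun K hK ↦ hK.2)
    (hX.sInf_le_of_isGeneralizedCoveringSubgroup hH), fun hH ↦ ?_⟩
  rw [hH, sInf_eq_iInf']
  exact isGeneralizedCoveringSubgroup_iInf fun K ↦ K.2.1
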